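/- Let $d\ge 1$, let $\Omega\subset\mathbb R^d$ be a bounded domain, and let $a>0$, $b\in\mathbb R\setminus\{0\}$. Let $\Delta$ be the Dirichlet Laplacian in $L^2(\Omega;\mathbb R)$, that is, $u\in H_0^1(\Omega)$ and $\Delta u\in L^2(\Omega)$ in the weak sense; let $\lambda_1\le\lambda_2\le\cdots\to+\infty$ be the eigenvalues of $-\Delta$, counted with multiplicity, and $\{e_i\}_{i\ge1}$ an orthonormal basis of $L^2(\Omega;\mathbb R)$ of corresponding eigenfunctions. For $\lambda>\lambda_1$ put $k_\lambda:=\max\{i\ge 1:\lambda_i\le\lambda\}$. Let $\{e^{\mathcal At}\}_{t\ge0}$ be the strongly continuous semigroup on $L^2(\Omega;\mathbb R^2)$ generated by $$\mathcal A=\begin{pmatrix} a\Delta & -b\Delta\\ b\Delta & a\Delta\end{pmatrix},$$ and let $B=(1,0)$, i.e. $Bz=z_1$ for $z=(z_1,z_2)^\top$. For every $D>0$ there is a constant $M>0$, depending only on $\Omega,a,b,D$, with the following property. Let $T>0$, let $E\subset(0,T)$ be a Lebesgue measurable set of positive measure, and let $\{\mathcal D_t\}_{t\in(0,T)}$ be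 a family of subsets of $\Omega$ such that (a) $\mathcal D_t$ is Lebesgue measurable for a.e. $t\in(0,T)$; (b) for every $f\in L^1(\Omega\times(0,T))$ the function $t\mapsto\int_\Omega\chi_{\mathcal D_t}(x)|f(x,t)|\,dx$ is integrable over $(0,T)$; (c) for a.e. $t\in E$, for all $\lambda>\lambda_1$ and all $\{a_i\}_{i=1}^{k_\lambda}\subset\mathbb R$, $$\sum_{i=1}^{k_\lambda}|a_i|^2\le D e^{D\sqrt\lambda}\,\Big\|\chi_{\mathcal D_t}\sum_{i=1}^{k_\lambda}a_ie_i\Big\|_{L^1(\Omega;\mathbb R)}^2 .$$ Then for all $\theta\in(0,1)$, all $0<S_1<S_2\le T$ with $|E\cap[S_1,S_2]|>0$, and all $z\in L^2(\Omega;\mathbb R^2)$, the function $t\mapsto\chi_E(t)\|\chi_{\mathcal D_t}Be^{\mathcal At}z\|_{L^1(\Omega;\mathbb R)}$ is integrable over $(S_1,S_2)$ and $$\|e^{\mathcal AS_2}z\|_{L^2(\Omega;\mathbb R^2)}\le \frac{M e^{M\left(\frac{S_2}{1-\theta}+\frac1{\theta S_1}\right)}}{|E\cap[S_1,S_2]|^3}\left(\frac1{|E\cap[S_1,S_2]|}\int_{S_1}^{S_2}\chi_E(t)\,\|\chi_{\mathcal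 D_t}Be^{\mathcal At}z\|_{L^1(\Omega;\mathbb R)}\,dt\right)^{1-\theta}\|z\|_{L^2(\Omega;\mathbb R^2)}^{\theta}.$$ -/

import Mathlib

open MeasureTheory Set Filter Topology
open scoped ContDiff

noncomputable section

/-- The real Hilbert space `L²(Ω; V)` for `Ω ⊆ ℝᵈ` with Lebesgue measure. -/
abbrev L2 {d : ℕ} (Ω : Set (EuclideanSpace ℝ (Fin d))) (V : Type*) [NormedAddCommGroup V] :
    Type _ :=
  Lp V 2 (volume.restrict Ω)

/-- The pairs `(φ, ∇φ)`, `φ ∈ C_c^∞(Ω)`, as a subset of `L²(Ω) × L²(Ω; ℝᵈ)`. -/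
def testGraph {d : ℕ} (Ω : Set (EuclideanSpace ℝ (Fin d))) :
    Set (L2 Ω ℝ × L2 Ω (EuclideanSpace ℝ (Fin d))) :=
  {p | ∃ φ : EuclideanSpace ℝ (Fin d) → ℝ, ContDiff ℝ ∞ φ ∧ HasCompactSupport φ ∧
    tsupport φ ⊆ Ω ∧ p.1 =ᵐ[volume.restrict Ω] φ ∧ p.2 =ᵐ[volume.restrict Ω] gradient φ}

/-- `u ∈ H₀¹(Ω)` with weak gradient `G`: the pair `(u, G)` is a limit in `L²` of pairs `(φ, ∇φ)`
with `φ ∈ C_c^∞(Ω)`, i.e. `u` lies in the closure of `C_c^∞(Ω)` for the `H¹` norm. -/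
def HasH10Gradient {d : ℕ} (Ω : Set (EuclideanSpace ℝ (Fin d))) (u : L2 Ω ℝ)
    (G : L2 Ω (EuclideanSpace ℝ (Fin d))) : Prop :=
  (u, G) ∈ closure (testGraph Ω)

/-- The graph of the Dirichlet Laplacian in `L²(Ω)`: `u ∈ H₀¹(Ω)`, and `Δu = f ∈ L²(Ω)` weakly,
i.e. `∫_Ω ∇u · ∇v = -∫_Ω f v` for all `v ∈ H₀¹(Ω)`. -/
def IsDirichletLaplacian {d : ℕ} (Ω : Set (EuclideanSpace ℝ (Fin d))) (u f : L2 Ω ℝ) : Prop :=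
  ∃ G, HasH10Gradient Ω u G ∧
    ∀ v Gv, HasH10Gradient Ω v Gv → inner ℝ G Gv = -inner ℝ f v

/-- `(e i)` is an orthonormal basis of `L²(Ω)` made of eigenfunctions of the Dirichlet operator
`-Δ`, with eigenvalues `lam i` in nondecreasing order (indices start at `0`). -/
structure IsDirichletEigenbasis {d : ℕ} (Ω : Set (EuclideanSpace ℝ (Fin d))) (lam : ℕ → ℝ)
    (e : HilbertBasis ℕ ℝ (L2 Ω ℝ)) : Prop where
  monotone : Monotone lam
  eigen : ∀ i, IsDirichletLaplacian Ω (e i) (-(lam i • e i))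

/-- The `i`-th component of `z ∈ L²(Ω; ℝ²)`. For `i = 0` this is `B z`, where `B = (1, 0)`. -/
def component {d : ℕ} {Ω : Set (EuclideanSpace ℝ (Fin d))} (i : Fin 2)
    (z : L2 Ω (EuclideanSpace ℝ (Fin 2))) : L2 Ω ℝ :=
  (EuclideanSpace.proj i : EuclideanSpace ℝ (Fin 2) →L[ℝ] ℝ).compLp z

/-- The graph of the operator `𝒜 = (aΔ, -bΔ; bΔ, aΔ)` in `L²(Ω; ℝ²)` with homogeneous Dirichlet
conditions: `𝒜 z = w`. -/
def CoupledOperator {d : ℕ} (Ω : Set (EuclideanSpace ℝ (Fin d))) (a b : ℝ)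
    (z w : L2 Ω (EuclideanSpace ℝ (Fin 2))) : Prop :=
  ∃ f₁ f₂ : L2 Ω ℝ,
    IsDirichletLaplacian Ω (component 0 z) f₁ ∧ IsDirichletLaplacian Ω (component 1 z) f₂ ∧
    component 0 w = a • f₁ - b • f₂ ∧ component 1 w = b • f₁ + a • f₂

/-- `(S t)`, `t ≥ 0`, is the strongly continuous semigroup on `H` whose infinitesimal generator is
the operator with graph `Gen` (values of `S` at negative times are irrelevant). -/
structure IsSemigroupGeneratedBy {H : Type*} [NormedAddCommGroup H] [NormedSpace ℝ H]
    (S : ℝ → H →L[ℝ] H) (Gen : H → H → Prop) : Prop where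
  at_zero : S 0 = ContinuousLinearMap.id ℝ H
  comp : ∀ s t, 0 ≤ s → 0 ≤ t → S (s + t) = (S s).comp (S t)
  continuousOn : ∀ z, ContinuousOn (fun t => S t z) (Ici 0)
  generator : ∀ z w,
    Gen z w ↔ Tendsto (fun t : ℝ => t⁻¹ • (S t z - z)) (𝓝[>] 0) (𝓝 w)

/-- `‖χ_A f‖_{L¹(Ω)}`. -/
def l1NormOn {d : ℕ} (Ω A : Set (EuclideanSpace ℝ (Fin d)))
    (f : EuclideanSpace ℝ (Fin d) → ℝ) : ℝ :=
  ∫ x in Ω, |A.indicator f x|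

/-- The `L¹` spectral inequality on `A` with constant `D`: for all `Λ > λ₁` and all real
`(cᵢ)_{i < k}` one has `∑ cᵢ² ≤ D exp (D √Λ) ‖χ_A ∑ cᵢ eᵢ‖²_{L¹(Ω)}`, where `k` is the number
`k_Λ` of eigenvalues `≤ Λ`. (The values `k < k_Λ`, which are allowed too, only add the instances
of `k = k_Λ` in which the last coefficients vanish.) -/
def SpectralInequality {d : ℕ} (Ω A : Set (EuclideanSpace ℝ (Fin d))) (lam : ℕ → ℝ)
    (e : HilbertBasis ℕ ℝ (L2 Ω ℝ)) (D : ℝ) : Prop :=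
  ∀ Λ : ℝ, lam 0 < Λ → ∀ k : ℕ, (∀ i < k, lam i ≤ Λ) → ∀ c : ℕ → ℝ,
    ∑ i ∈ Finset.range k, c i ^ 2 ≤
      D * Real.exp (D * √Λ) *
        l1NormOn Ω A (fun x => ∑ i ∈ Finset.range k, c i * (e i : L2 Ω ℝ) x) ^ 2

end

/-! Identify `z = (z₁, z₂)` with `z₁ + i z₂`: the system becomes the complex heat equation
`z' = (a + ib) Δz`, whose `i`-th Fourier coefficient is `exp (-(a + ib) λᵢ t) ζᵢ`. The `i`-th
coefficient of the observed component is thus `exp (-a λᵢ t) |ζᵢ| cos (b λᵢ t - arg ζᵢ)`. A sinusoid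
is small only on a set of small measure, uniformly in its frequency as long as the latter stays away
from `0`, which Poincaré's inequality ensures. Hence the `L¹`-in-time norm of that coefficient over
`E ∩ [S₁, S₂]` controls the modulus of the whole `i`-th coefficient at time `S₂`. Minkowski's
inequality passes from single modes to all modes with `λᵢ < Λ`, and the spectral inequality then
bounds `e^{𝒜S₂} z` by the observation at cost `exp (D √Λ / 2)`, up to the high modes, which have
decayed to `exp (-a Λ S₁) ‖z‖`. Optimizing over `Λ` gives the interpolation inequality. -/

lemma integral_sq_le_integral_fderiv_sq_of_abs_le {E : Type*} [NormedAddCommGroup E]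
    [NormedSpace ℝ E] [FiniteDimensional ℝ E] [MeasurableSpace E] [BorelSpace E]
    (μ : Measure E) [μ.IsAddHaarMeasure] {π : E →L[ℝ] ℝ} {v : E} (hv : π v = 1) {R : ℝ}
    {φ : E → ℝ} (hφ : ContDiff ℝ 1 φ) (hc : HasCompactSupport φ)
    (hR : ∀ x ∈ tsupport φ, |π x| ≤ R) :
    ∫ x, φ x ^ 2 ∂μ ≤ 4 * R ^ 2 * ∫ x, fderiv ℝ φ x v ^ 2 ∂μ := by
  have hφ' : Continuous fun x => fderiv ℝ φ x v :=
    (hφ.continuous_fderiv one_ne_zero).clm_apply continuous_const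
  have hc' : HasCompactSupport fun x => fderiv ℝ φ x v := hc.fderiv_apply ℝ v
  have sq_fderiv (x : E) : fderiv ℝ (fun y => φ y ^ 2) x v = 2 * φ x * fderiv ℝ φ x v := by
    simp [((hφ.differentiable one_ne_zero x).hasFDerivAt.pow 2).fderiv]
  have int_sq : Integrable (fun x => φ x ^ 2) μ :=
    (hφ.continuous.pow 2).integrable_of_hasCompactSupport (by simpa [sq] using hc.mul_left)
  have int_fderiv_sq : Integrable (fun x => fderiv ℝ φ x v ^ 2) μ :=
    (hφ'.pow 2).integrable_of_hasCompactSupport (by simpa [sq] using hc'.mul_left)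
  have int_mul : Integrable (fun x => π x * (2 * φ x * fderiv ℝ φ x v)) μ :=
    (π.continuous.mul
      ((continuous_const.mul hφ.continuous).mul hφ')).integrable_of_hasCompactSupport
      hc'.mul_left.mul_left
  have int_pi_sq : Integrable (fun x => π x * φ x ^ 2) μ :=
    (π.continuous.mul (hφ.continuous.pow 2)).integrable_of_hasCompactSupport
      (by simpa only [sq] using hc.mul_left.mul_left)
  have by_parts : ∫ x, π x * (2 * φ x * fderiv ℝ φ x v) ∂μ = -∫ x, φ x ^ 2 ∂μ := by
    simpa [sq_fderiv, hv] using integral_mul_fderiv_eq_neg_fderiv_mul_of_integrable (μ := μ)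
      (f := π) (g := fun x => φ x ^ 2) (v := v) (by simpa [hv] using int_sq)
      (by simpa [sq_fderiv] using int_mul) int_pi_sq (fun x _ => π.differentiableAt)
      (fun x _ => (hφ.differentiable one_ne_zero x).pow 2)
  have young (x : E) : -(π x * (2 * φ x * fderiv ℝ φ x v)) ≤
      φ x ^ 2 / 2 + 2 * R ^ 2 * fderiv ℝ φ x v ^ 2 := by
    by_cases hx : x ∈ tsupport φ
    · have : π x ^ 2 ≤ R ^ 2 := sq_le_sq' (abs_le.1 (hR x hx)).1 (abs_le.1 (hR x hx)).2
      nlinarith [sq_nonneg (φ x + 2 * (π x * fderiv ℝ φ x v)),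
        mul_le_mul_of_nonneg_right this (sq_nonneg (fderiv ℝ φ x v))]
    · simpa [image_eq_zero_of_notMem_tsupport hx] using by positivity
  have := integral_mono int_mul.neg ((int_sq.div_const 2).add (int_fderiv_sq.const_mul _)) young
  simp only [Pi.neg_apply, integral_neg, by_parts] at this
  rw [integral_add' (int_sq.div_const 2) (int_fderiv_sq.const_mul _), integral_div,
    integral_const_mul] at this
  linarith

lemma norm_sq_eq_integral_norm_sq {α V : Type*} [MeasurableSpace α] {μ : Measure α}
    [NormedAddCommGroup V] [InnerProductSpace ℝ V] (f : Lp V 2 μ) :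
    ‖f‖ ^ 2 = ∫ x, ‖f x‖ ^ 2 ∂μ := by
  simp only [← real_inner_self_eq_norm_sq, L2.inner_def]

section Poincare

variable {d : ℕ} {Ω : Set (EuclideanSpace ℝ (Fin d))} {π : EuclideanSpace ℝ (Fin d) →L[ℝ] ℝ}
  {v : EuclideanSpace ℝ (Fin d)} {R : ℝ}

lemma HasH10Gradient.norm_sq_le (hv : π v = 1) (hR : ∀ x ∈ Ω, |π x| ≤ R) {u : L2 Ω ℝ}
    {G : L2 Ω (EuclideanSpace ℝ (Fin d))} (h : HasH10Gradient Ω u G) :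
    ‖u‖ ^ 2 ≤ 4 * R ^ 2 * (‖v‖ ^ 2 * ‖G‖ ^ 2) := by
  have hclosed : IsClosed {p : L2 Ω ℝ × L2 Ω (EuclideanSpace ℝ (Fin d)) |
      ‖p.1‖ ^ 2 ≤ 4 * R ^ 2 * (‖v‖ ^ 2 * ‖p.2‖ ^ 2)} := isClosed_le (by fun_prop) (by fun_prop)
  have hmem : (u, G) ∈ closure (testGraph Ω) := h
  suffices hsub : testGraph Ω ⊆ {p | ‖p.1‖ ^ 2 ≤ 4 * R ^ 2 * (‖v‖ ^ 2 * ‖p.2‖ ^ 2)} by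
    have := closure_minimal hsub hclosed hmem
    exact this
  rintro ⟨p, q⟩ ⟨φ, hφ, hc, hs, hp, hq⟩
  have norm_p : ‖p‖ ^ 2 = ∫ x, φ x ^ 2 := by
    rw [norm_sq_eq_integral_norm_sq, integral_congr_ae (hp.mono fun x hx => by rw [hx])]
    simpa using setIntegral_eq_integral_of_forall_compl_eq_zero fun x hx => by
      simp [image_eq_zero_of_notMem_tsupport fun h => hx (hs h)]
  have fderiv_le : ∫ x, fderiv ℝ φ x v ^ 2 ≤ ‖v‖ ^ 2 * ‖q‖ ^ 2 := by
    rw [norm_sq_eq_integral_norm_sq, ← integral_const_mul,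
      ← setIntegral_eq_integral_of_forall_compl_eq_zero (s := Ω) fun x hx => ?_]
    · refine integral_mono_of_nonneg (.of_forall fun x => sq_nonneg _)
        ((Lp.memLp q).integrable_norm_pow two_ne_zero |>.const_mul _) (hq.mono fun x hx => ?_)
      dsimp only at hx ⊢
      rw [hx, ← inner_gradient_left, ← mul_pow, mul_comm ‖v‖]
      exact sq_le_sq' (abs_le.1 (abs_real_inner_le_norm _ _)).1 (real_inner_le_norm _ _)
    · have : fderiv ℝ φ x = 0 := image_eq_zero_of_notMem_tsupport fun h =>
        hx (hs (tsupport_fderiv_subset ℝ h))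
      simp [this]
  exact norm_p.trans_le <| (integral_sq_le_integral_fderiv_sq_of_abs_le volume hv
    (hφ.of_le (by simp)) hc fun x hx => hR x (hs hx)).trans (by gcongr)

variable {lam : ℕ → ℝ} {e : HilbertBasis ℕ ℝ (L2 Ω ℝ)}

lemma IsDirichletEigenbasis.exists_gradient_norm_sq_eq (h : IsDirichletEigenbasis Ω lam e)
    (i : ℕ) : ∃ G, HasH10Gradient Ω (e i) G ∧ ‖G‖ ^ 2 = lam i := by
  obtain ⟨G, hG, hweak⟩ := h.eigen i
  exact ⟨G, hG, by simpa [inner_smul_left, e.orthonormal.norm_eq_one i] using hweak _ _ hG⟩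

lemma IsDirichletEigenbasis.lam_nonneg (h : IsDirichletEigenbasis Ω lam e) (i : ℕ) :
    0 ≤ lam i := by
  obtain ⟨G, -, norm_G⟩ := h.exists_gradient_norm_sq_eq i
  exact norm_G ▸ sq_nonneg _

lemma IsDirichletEigenbasis.one_le_mul_lam (hv : π v = 1) (hR : ∀ x ∈ Ω, |π x| ≤ R)
    (h : IsDirichletEigenbasis Ω lam e) (i : ℕ) :
    1 ≤ 4 * R ^ 2 * ‖v‖ ^ 2 * lam i := by
  obtain ⟨G, hG, norm_G⟩ := h.exists_gradient_norm_sq_eq i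
  simpa [e.orthonormal.norm_eq_one i, norm_G, mul_assoc] using hG.norm_sq_le hv hR

end Poincare

lemma exists_int_abs_sub_le_mul_abs_cos (s : ℝ) :
    ∃ n : ℤ, |s - (Real.pi / 2 + n * Real.pi)| ≤ Real.pi / 2 * |Real.cos s| := by
  set n := round ((s - Real.pi / 2) / Real.pi)
  set u := s - (Real.pi / 2 + n * Real.pi) with hu
  have hπ := Real.pi_pos
  have abs_le : |u| ≤ Real.pi / 2 := by
    have : u = ((s - Real.pi / 2) / Real.pi - n) * Real.pi := by rw [hu]; field_simp; ring
    rw [this, abs_mul, abs_of_pos hπ]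
    nlinarith [abs_sub_round ((s - Real.pi / 2) / Real.pi)]
  have abs_cos : |Real.cos s| = |Real.sin u| := by
    rw [show s = u + Real.pi / 2 + n * Real.pi by rw [hu]; ring, Real.cos_add_int_mul_pi,
      Real.cos_add_pi_div_two, abs_mul, abs_neg, abs_zpow, abs_neg, abs_one, one_zpow, one_mul]
  refine ⟨n, ?_⟩
  have := Real.mul_abs_le_abs_sin abs_le
  rw [abs_cos]
  calc |u| = Real.pi / 2 * (2 / Real.pi * |u|) := by field_simp
    _ ≤ Real.pi / 2 * |Real.sin u| := by gcongr

lemma volume_Icc_inter_iUnion_closedBall_le {α β c p η : ℝ} (hαβ : α ≤ β) (hp : 0 < p)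
    (hη : 0 ≤ η) :
    volume (Icc α β ∩ ⋃ n : ℤ, Metric.closedBall (c + n * p) η) ≤
      ENNReal.ofReal (((β - α + 2 * η) / p + 1) * (2 * η)) := by
  set N : Finset ℤ := Finset.Icc ⌈(α - η - c) / p⌉ ⌊(β + η - c) / p⌋
  have subset : Icc α β ∩ ⋃ n : ℤ, Metric.closedBall (c + n * p) η ⊆
      ⋃ n ∈ N, Metric.closedBall (c + n * p) η := by
    rintro t ⟨ht, hmem⟩
    obtain ⟨n, hn⟩ := mem_iUnion.1 hmem
    refine mem_biUnion (Finset.mem_Icc.2 ⟨Int.ceil_le.2 ?_, Int.le_floor.2 ?_⟩) hn <;>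
      obtain ⟨h₁, h₂⟩ := Real.closedBall_eq_Icc ▸ hn
    · rw [div_le_iff₀ hp]; linarith [ht.1]
    · rw [le_div_iff₀ hp]; linarith [ht.2]
  have card_le : (N.card : ℝ) ≤ (β - α + 2 * η) / p + 1 := by
    have hdiff : (β + η - c) / p - (α - η - c) / p = (β - α + 2 * η) / p := by ring
    have hnonneg : 0 ≤ (β - α + 2 * η) / p := by have := sub_nonneg.2 hαβ; positivity
    rw [Int.card_Icc, ← Int.cast_natCast, Int.toNat_eq_max, Int.cast_max]
    push_cast
    exact max_le (by linarith [Int.floor_le ((β + η - c) / p), Int.le_ceil ((α - η - c) / p)])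
      (by linarith)
  calc _ ≤ ∑ n ∈ N, volume (Metric.closedBall (c + n * p) η) :=
        (measure_mono subset).trans (measure_biUnion_finset_le _ _)
    _ = ENNReal.ofReal (N.card * (2 * η)) := by
        simp [Real.volume_closedBall, ENNReal.ofReal_mul]
    _ ≤ _ := by gcongr

lemma volume_abs_cos_lt_le {ν φ α β ε : ℝ} (hν : ν ≠ 0) (hαβ : α ≤ β) (hε : 0 ≤ ε) (hε1 : ε ≤ 1) :
    volume {t ∈ Icc α β | |Real.cos (ν * t - φ)| < ε} ≤
      ENNReal.ofReal ((β - α + 2 * Real.pi / |ν|) * ε) := by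
  wlog hpos : 0 < ν generalizing ν φ
  · have := this (ν := -ν) (φ := -φ) (neg_ne_zero.2 hν)
      (neg_pos.2 (lt_of_le_of_ne (not_lt.1 hpos) hν))
    simpa only [abs_neg, neg_mul, ← neg_sub', Real.cos_neg] using this
  rw [abs_of_pos hpos]
  have subset : {t ∈ Icc α β | |Real.cos (ν * t - φ)| < ε} ⊆ Icc α β ∩ ⋃ n : ℤ,
      Metric.closedBall ((φ + Real.pi / 2) / ν + n * (Real.pi / ν)) (Real.pi * ε / (2 * ν)) := by
    rintro t ⟨ht, hcos⟩
    obtain ⟨n, hn⟩ := exists_int_abs_sub_le_mul_abs_cos (ν * t - φ)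
    refine ⟨ht, mem_iUnion.2 ⟨n, ?_⟩⟩
    have : t - ((φ + Real.pi / 2) / ν + n * (Real.pi / ν)) =
        (ν * t - φ - (Real.pi / 2 + n * Real.pi)) / ν := by field_simp; ring
    rw [Metric.mem_closedBall, Real.dist_eq, this, abs_div, abs_of_pos hpos, div_le_div_iff₀ hpos
      (by positivity)]
    nlinarith [mul_le_mul_of_nonneg_left hcos.le Real.pi_pos.le]
  refine ((measure_mono subset).trans (volume_Icc_inter_iUnion_closedBall_le hαβ
    (by positivity) (by positivity))).trans (ENNReal.ofReal_le_ofReal ?_)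
  calc ((β - α + 2 * (Real.pi * ε / (2 * ν))) / (Real.pi / ν) + 1) * (2 * (Real.pi * ε / (2 * ν)))
      = (β - α + Real.pi / ν * (ε + 1)) * ε := by field_simp; ring
    _ ≤ (β - α + Real.pi / ν * (1 + 1)) * ε := by gcongr
    _ = (β - α + 2 * Real.pi / ν) * ε := by ring

lemma mul_half_le_integral_of_measureReal_lt_le {X : Type*} [MeasurableSpace X] {μ : Measure X}
    [IsFiniteMeasure μ] {f : X → ℝ} (hf : 0 ≤ f) (hint : Integrable f μ) {ε : ℝ} (hε : 0 ≤ ε)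
    (h : μ.real {x | f x < ε} ≤ μ.real univ / 2) :
    ε * (μ.real univ / 2) ≤ ∫ x, f x ∂μ := by
  have large : μ.real univ / 2 ≤ μ.real {x | ε ≤ f x} := by
    have := measureReal_union_le (μ := μ) {x | f x < ε} {x | ε ≤ f x}
    rw [show {x | f x < ε} ∪ {x | ε ≤ f x} = univ from
      eq_univ_of_forall fun x => lt_or_ge (f x) ε] at this
    linarith
  exact (mul_le_mul_of_nonneg_left large hε).trans
    (mul_meas_ge_le_integral_of_nonneg (.of_forall hf) hint ε)

lemma sq_div_le_setIntegral_abs_cos {ν ν₀ φ α β : ℝ} (hν₀ : 0 < ν₀) (hν : ν₀ ≤ |ν|) (hαβ : α ≤ β)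
    {F : Set ℝ} (hF : F ⊆ Icc α β) :
    volume.real F ^ 2 / (4 * (β - α + 2 * Real.pi / ν₀)) ≤ ∫ t in F, |Real.cos (ν * t - φ)| := by
  have hcont : Continuous fun t => |Real.cos (ν * t - φ)| := by fun_prop
  have F_ne_top : volume F ≠ ⊤ := measure_ne_top_of_subset hF isCompact_Icc.measure_ne_top
  have hL : 0 < β - α + 2 * Real.pi / ν₀ := by have := sub_nonneg.2 hαβ; positivity
  set m := volume.real F
  set L := β - α + 2 * Real.pi / ν₀
  set ε := m / (2 * L) with hε
  have m_le : m ≤ L := by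
    have : m ≤ β - α := by
      simpa [hαβ] using measureReal_mono (μ := volume) hF isCompact_Icc.measure_ne_top
    have : 0 ≤ 2 * Real.pi / ν₀ := by positivity
    linarith
  have small_le : (volume.restrict F).real {t | |Real.cos (ν * t - φ)| < ε} ≤ m / 2 := by
    refine ENNReal.toReal_le_of_le_ofReal (by positivity) ?_
    rw [Measure.restrict_apply (isOpen_lt hcont continuous_const).measurableSet]
    calc _ ≤ volume {t ∈ Icc α β | |Real.cos (ν * t - φ)| < ε} :=
          measure_mono fun t ht => ⟨hF ht.2, ht.1⟩
      _ ≤ ENNReal.ofReal ((β - α + 2 * Real.pi / |ν|) * ε) :=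
          volume_abs_cos_lt_le (abs_pos.1 (hν₀.trans_le hν)) hαβ (by positivity)
            (div_le_one_of_le₀ (by linarith) (by positivity))
      _ ≤ ENNReal.ofReal (L * ε) := by simp only [L]; gcongr
      _ = ENNReal.ofReal (m / 2) := by rw [hε]; field_simp
  have : Fact (volume F < ⊤) := ⟨F_ne_top.lt_top⟩
  calc m ^ 2 / (4 * L) = ε * ((volume.restrict F).real univ / 2) := by
        rw [measureReal_restrict_apply_univ, hε]; field_simp; ring
    _ ≤ ∫ t in F, |Real.cos (ν * t - φ)| :=
        mul_half_le_integral_of_measureReal_lt_le (fun _ => abs_nonneg _)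
          (hcont.integrableOn_Icc.mono_set hF) (by positivity)
          (by rwa [measureReal_restrict_apply_univ])

section Components

variable {d : ℕ} {Ω : Set (EuclideanSpace ℝ (Fin d))}

/-- `component i` as a continuous linear map. -/
noncomputable def componentL (Ω : Set (EuclideanSpace ℝ (Fin d))) (i : Fin 2) :
    L2 Ω (EuclideanSpace ℝ (Fin 2)) →L[ℝ] L2 Ω ℝ :=
  (EuclideanSpace.proj i : EuclideanSpace ℝ (Fin 2) →L[ℝ] ℝ).compLpL 2 (volume.restrict Ω)

/-- The inclusion `L²(Ω) → L²(Ω; ℝ²)` onto the `i`-th coordinate, a right inverse of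
`component i`. -/
noncomputable def inclusionL (Ω : Set (EuclideanSpace ℝ (Fin d))) (i : Fin 2) :
    L2 Ω ℝ →L[ℝ] L2 Ω (EuclideanSpace ℝ (Fin 2)) :=
  (ContinuousLinearMap.toSpanSingleton ℝ (EuclideanSpace.single i (1 : ℝ))).compLpL 2
    (volume.restrict Ω)

lemma componentL_apply (i : Fin 2) (z : L2 Ω (EuclideanSpace ℝ (Fin 2))) :
    componentL Ω i z = component i z := rfl

lemma coeFn_component (i : Fin 2) (z : L2 Ω (EuclideanSpace ℝ (Fin 2))) :
    component i z =ᵐ[volume.restrict Ω] fun x => z x i :=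
  (EuclideanSpace.proj i : EuclideanSpace ℝ (Fin 2) →L[ℝ] ℝ).coeFn_compLp z

lemma coeFn_inclusionL (i : Fin 2) (f : L2 Ω ℝ) :
    inclusionL Ω i f =ᵐ[volume.restrict Ω] fun x => f x • EuclideanSpace.single i (1 : ℝ) :=
  (ContinuousLinearMap.toSpanSingleton ℝ (EuclideanSpace.single i (1 : ℝ))).coeFn_compLp f

lemma component_inclusionL (i j : Fin 2) (f : L2 Ω ℝ) :
    component j (inclusionL Ω i f) = if j = i then f else 0 := by
  refine Lp.ext ?_
  filter_upwards [coeFn_component j (inclusionL Ω i f), coeFn_inclusionL i f,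
    Lp.coeFn_zero ℝ 2 (volume.restrict Ω)] with x hj hi hzero
  split_ifs with h
  · subst h; simp [hj, hi]
  · rw [hj, hi, hzero]; simp [h]

lemma inclusionL_component_add (z : L2 Ω (EuclideanSpace ℝ (Fin 2))) :
    inclusionL Ω 0 (component 0 z) + inclusionL Ω 1 (component 1 z) = z := by
  refine Lp.ext ?_
  filter_upwards [Lp.coeFn_add (inclusionL Ω 0 (component 0 z)) (inclusionL Ω 1 (component 1 z)),
    coeFn_inclusionL 0 (component 0 z), coeFn_inclusionL 1 (component 1 z),
    coeFn_component 0 z, coeFn_component 1 z] with x hadd hi₀ hi₁ h₀ h₁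
  rw [hadd, Pi.add_apply, hi₀, hi₁, h₀, h₁]
  ext i
  fin_cases i <;> simp

lemma norm_sq_eq_component (z : L2 Ω (EuclideanSpace ℝ (Fin 2))) :
    ‖z‖ ^ 2 = ‖component 0 z‖ ^ 2 + ‖component 1 z‖ ^ 2 := by
  have hint (f : L2 Ω ℝ) : Integrable (fun x => ‖f x‖ ^ 2) (volume.restrict Ω) :=
    (Lp.memLp f).integrable_norm_pow two_ne_zero
  simp only [norm_sq_eq_integral_norm_sq]
  rw [← integral_add (hint _) (hint _)]
  refine integral_congr_ae ?_
  filter_upwards [coeFn_component 0 z, coeFn_component 1 z] with x h₀ h₁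
  rw [EuclideanSpace.norm_sq_eq, Fin.sum_univ_two, h₀, h₁]

lemma norm_component_le (i : Fin 2) (z : L2 Ω (EuclideanSpace ℝ (Fin 2))) :
    ‖component i z‖ ≤ ‖z‖ := by
  refine abs_le_of_sq_le_sq' ?_ (norm_nonneg _) |>.2
  rw [norm_sq_eq_component z]
  fin_cases i <;> simp

lemma HasH10Gradient.const_smul {u : L2 Ω ℝ} {G : L2 Ω (EuclideanSpace ℝ (Fin d))}
    (h : HasH10Gradient Ω u G) (c : ℝ) : HasH10Gradient Ω (c • u) (c • G) := by
  have hmem : (u, G) ∈ closure (testGraph Ω) := h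
  suffices hmaps : MapsTo (c • ·) (testGraph Ω) (testGraph Ω) by
    have := map_mem_closure (continuous_const_smul c) hmem hmaps
    exact this
  rintro ⟨p, q⟩ ⟨φ, hφ, hc, hs, hp, hq⟩
  refine ⟨c • φ, hφ.const_smul c, hc.smul_left,
    (tsupport_smul_subset_right (fun _ => c) φ).trans hs,
    (Lp.coeFn_smul c p).trans (hp.const_smul c),
    (Lp.coeFn_smul c q).trans ((hq.const_smul c).trans (.of_forall fun x => ?_))⟩
  simp [gradient, fderiv_const_smul (hφ.differentiable (by simp) x) c]

lemma IsDirichletLaplacian.const_smul {u f : L2 Ω ℝ} (h : IsDirichletLaplacian Ω u f) (c : ℝ) :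
    IsDirichletLaplacian Ω (c • u) (c • f) := by
  obtain ⟨G, hG, hweak⟩ := h
  exact ⟨c • G, hG.const_smul c, fun v Gv hv => by
    rw [real_inner_smul_left, real_inner_smul_left, hweak v Gv hv, mul_neg]⟩

end Components

section Modes

variable {d : ℕ} {Ω : Set (EuclideanSpace ℝ (Fin d))} (e : HilbertBasis ℕ ℝ (L2 Ω ℝ))

/-- The span of `(eᵢ, 0)` and `(0, eᵢ)` in `L²(Ω; ℝ²)`, parametrized by `ℂ` through
`w ↦ (Re w eᵢ, Im w eᵢ)`. -/
noncomputable def modeEmbedding (i : ℕ) : ℂ →L[ℝ] L2 Ω (EuclideanSpace ℝ (Fin 2)) :=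
  Complex.reCLM.smulRight (inclusionL Ω 0 (e i)) + Complex.imCLM.smulRight (inclusionL Ω 1 (e i))

/-- The complex Fourier coefficient `⟨eᵢ, z₁⟩ + i ⟨eᵢ, z₂⟩` of `z = (z₁, z₂)`. -/
noncomputable def modeCoeff (i : ℕ) : L2 Ω (EuclideanSpace ℝ (Fin 2)) →L[ℝ] ℂ :=
  Complex.equivRealProdCLM.symm.toContinuousLinearMap ∘L
    ((innerSL ℝ (e i) ∘L componentL Ω 0).prod (innerSL ℝ (e i) ∘L componentL Ω 1))

lemma modeCoeff_re (i : ℕ) (z : L2 Ω (EuclideanSpace ℝ (Fin 2))) :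
    (modeCoeff e i z).re = inner ℝ (e i) (component 0 z) := rfl

lemma modeCoeff_im (i : ℕ) (z : L2 Ω (EuclideanSpace ℝ (Fin 2))) :
    (modeCoeff e i z).im = inner ℝ (e i) (component 1 z) := rfl

lemma component_modeEmbedding (i : ℕ) (w : ℂ) :
    component 0 (modeEmbedding e i w) = w.re • e i ∧
      component 1 (modeEmbedding e i w) = w.im • e i := by
  simp only [← componentL_apply, modeEmbedding, add_apply,
    ContinuousLinearMap.smulRight_apply, map_add, map_smul]
  simp [componentL_apply, component_inclusionL]

lemma modeCoeff_modeEmbedding (i j : ℕ) (w : ℂ) :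
    modeCoeff e i (modeEmbedding e j w) = if i = j then w else 0 := by
  have h := orthonormal_iff_ite.1 e.orthonormal i j
  apply Complex.ext <;>
    simp only [modeCoeff_re, modeCoeff_im, component_modeEmbedding, inner_smul_right, h] <;>
    split_ifs <;> simp

lemma hasSum_modeEmbedding_modeCoeff (z : L2 Ω (EuclideanSpace ℝ (Fin 2))) :
    HasSum (fun i => modeEmbedding e i (modeCoeff e i z)) z := by
  have h (j : Fin 2) := (e.hasSum_repr (component j z)).mapL (inclusionL Ω j)
  simpa [modeEmbedding, modeCoeff_re, modeCoeff_im, e.repr_apply_apply, inclusionL_component_add]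
    using (h 0).add (h 1)

lemma hasSum_norm_modeCoeff_sq (z : L2 Ω (EuclideanSpace ℝ (Fin 2))) :
    HasSum (fun i => ‖modeCoeff e i z‖ ^ 2) (‖z‖ ^ 2) := by
  have h (j : Fin 2) := e.hasSum_inner_mul_inner (component j z) (component j z)
  simpa [norm_sq_eq_component z, Complex.sq_norm, Complex.normSq_apply, modeCoeff_re,
    modeCoeff_im, real_inner_comm (e _)] using (h 0).add (h 1)

variable {e} in
lemma IsDirichletEigenbasis.coupledOperator_modeEmbedding {lam : ℕ → ℝ}
    (h : IsDirichletEigenbasis Ω lam e) (a b : ℝ) (i : ℕ) (w : ℂ) :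
    CoupledOperator Ω a b (modeEmbedding e i w)
      (modeEmbedding e i (-(a + b * Complex.I) * lam i * w)) := by
  refine ⟨w.re • -(lam i • e i), w.im • -(lam i • e i), ?_, ?_, ?_, ?_⟩ <;>
    simp only [component_modeEmbedding]
  · exact (h.eigen i).const_smul _
  · exact (h.eigen i).const_smul _
  · simp; module
  · simp; module

end Modes

section Semigroup

variable {H : Type*} [NormedAddCommGroup H] [NormedSpace ℝ H] {S : ℝ → H →L[ℝ] H}
  {Gen : H → H → Prop}

lemma IsSemigroupGeneratedBy.hasDerivWithinAt (hS : IsSemigroupGeneratedBy S Gen) {z w : H}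
    (h : Gen z w) {t : ℝ} (ht : 0 ≤ t) :
    HasDerivWithinAt (fun s => S s z) (S t w) (Ici t) t := by
  rw [← hasDerivWithinAt_Ioi_iff_Ici, hasDerivWithinAt_iff_tendsto_slope' self_notMem_Ioi]
  have hshift : Tendsto (fun s => s - t) (𝓝[>] t) (𝓝[>] 0) :=
    tendsto_nhdsWithin_iff.2
      ⟨((continuous_sub_right t).tendsto' t 0 (sub_self t)).mono_left nhdsWithin_le_nhds,
        eventually_nhdsWithin_of_forall fun s hs => mem_Ioi.2 (sub_pos.2 hs)⟩
  refine (((S t).continuous.tendsto w).comp (((hS.generator z w).1 h).comp hshift)).congr' ?_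
  filter_upwards [self_mem_nhdsWithin] with s hs
  have : S s = (S t).comp (S (s - t)) := by
    rw [← hS.comp t (s - t) ht (sub_nonneg.2 (mem_Ioi.1 hs).le), add_sub_cancel]
  simp [slope, this]

lemma clm_complex_apply (B : ℂ →L[ℝ] H) (w : ℂ) : B w = w.re • B 1 + w.im • B Complex.I := by
  rw [← map_smul, ← map_smul, ← map_add]
  simp

/-- The orbit solves `x' = μ x` on the invariant plane, so `s ↦ S s (exp (μ (t - s)) w)` is
constant on `[0, t]`. -/
lemma IsSemigroupGeneratedBy.apply_eq_exp (hS : IsSemigroupGeneratedBy S Gen) {B : ℂ →L[ℝ] H}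
    {μ : ℂ} (hB : ∀ w, Gen (B w) (B (μ * w))) {t : ℝ} (ht : 0 ≤ t) (w : ℂ) :
    S t (B w) = B (Complex.exp (μ * t) * w) := by
  set c : ℝ → ℂ := fun s => Complex.exp (μ * (t - s)) * w with hc
  have deriv_c (s : ℝ) : HasDerivAt c (-μ * c s) s := by
    have : HasDerivAt (fun s : ℝ => μ * (t - s)) (-μ) s := by
      simpa using ((hasDerivAt_id s).ofReal_comp.const_sub (t : ℂ)).const_mul μ
    exact (this.cexp.mul_const w).congr_deriv (by ring)
  have deriv_re (s : ℝ) : HasDerivAt (fun s => (c s).re) (-μ * c s).re s :=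
    Complex.reCLM.hasFDerivAt.comp_hasDerivAt s (deriv_c s)
  have deriv_im (s : ℝ) : HasDerivAt (fun s => (c s).im) (-μ * c s).im s :=
    Complex.imCLM.hasFDerivAt.comp_hasDerivAt s (deriv_c s)
  have deriv_orbit (v : ℂ) {s : ℝ} (hs : 0 ≤ s) :
      HasDerivWithinAt (fun s => S s (B v)) (S s (B (μ * v))) (Ici s) s :=
    hS.hasDerivWithinAt (hB v) hs
  have orbit_eq (s : ℝ) (v : ℂ) : S s (B v) = v.re • S s (B 1) + v.im • S s (B Complex.I) :=
    clm_complex_apply ((S s).comp B) v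
  have deriv_zero {s : ℝ} (hs : 0 ≤ s) :
      HasDerivWithinAt (fun s => S s (B (c s))) 0 (Ici s) s := by
    simp only [fun s => orbit_eq s (c s)]
    refine (((deriv_re s).hasDerivWithinAt.smul (deriv_orbit 1 hs)).add
      ((deriv_im s).hasDerivWithinAt.smul (deriv_orbit Complex.I hs))).congr_deriv ?_
    have hμ : S s (B (μ * c s)) =
        (c s).re • S s (B (μ * 1)) + (c s).im • S s (B (μ * Complex.I)) :=
      clm_complex_apply ((S s).comp (B.comp (ContinuousLinearMap.mul ℝ ℂ μ))) (c s)
    calc _ = S s (B (μ * c s)) + S s (B (-μ * c s)) := by rw [hμ, orbit_eq s (-μ * c s)]; abel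
      _ = 0 := by rw [← map_add, ← map_add, neg_mul, add_neg_cancel, map_zero, map_zero]
  have continuousOn : ContinuousOn (fun s => S s (B (c s))) (Icc 0 t) := by
    have hcont (v : H) := (hS.continuousOn v).mono (Icc_subset_Ici_self : Icc 0 t ⊆ Ici 0)
    simp only [fun s => orbit_eq s (c s)]
    exact ((by fun_prop : Continuous fun s => (c s).re).continuousOn.smul (hcont _)).add
      ((by fun_prop : Continuous fun s => (c s).im).continuousOn.smul (hcont _))
  have := constant_of_has_deriv_right_zero continuousOn (fun s hs => deriv_zero hs.1) t
    (right_mem_Icc.2 ht)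
  simpa [hc, hS.at_zero] using this

end Semigroup

section SemigroupModes

variable {d : ℕ} {Ω : Set (EuclideanSpace ℝ (Fin d))} {a b : ℝ} {lam : ℕ → ℝ}
  {e : HilbertBasis ℕ ℝ (L2 Ω ℝ)}
  {S : ℝ → L2 Ω (EuclideanSpace ℝ (Fin 2)) →L[ℝ] L2 Ω (EuclideanSpace ℝ (Fin 2))}

lemma IsDirichletEigenbasis.modeCoeff_semigroup (h : IsDirichletEigenbasis Ω lam e)
    (hS : IsSemigroupGeneratedBy S (CoupledOperator Ω a b)) {t : ℝ} (ht : 0 ≤ t)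
    (z : L2 Ω (EuclideanSpace ℝ (Fin 2))) (i : ℕ) :
    modeCoeff e i (S t z) =
      Complex.exp (-(a + b * Complex.I) * lam i * t) * modeCoeff e i z := by
  have expansion := (hasSum_modeEmbedding_modeCoeff e z).mapL (modeCoeff e i ∘L S t)
  have hexp (j : ℕ) := hS.apply_eq_exp (h.coupledOperator_modeEmbedding a b j) ht
  simpa [hexp, modeCoeff_modeEmbedding, eq_comm (a := i)] using expansion.tsum_eq.symm

lemma IsDirichletEigenbasis.norm_modeCoeff_semigroup (h : IsDirichletEigenbasis Ω lam e)
    (hS : IsSemigroupGeneratedBy S (CoupledOperator Ω a b)) {t : ℝ} (ht : 0 ≤ t)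
    (z : L2 Ω (EuclideanSpace ℝ (Fin 2))) (i : ℕ) :
    ‖modeCoeff e i (S t z)‖ = Real.exp (-(a * lam i * t)) * ‖modeCoeff e i z‖ := by
  rw [h.modeCoeff_semigroup hS ht, norm_mul, Complex.norm_exp]
  simp

lemma IsDirichletEigenbasis.abs_inner_component_zero_semigroup (h : IsDirichletEigenbasis Ω lam e)
    (hS : IsSemigroupGeneratedBy S (CoupledOperator Ω a b)) {t : ℝ} (ht : 0 ≤ t)
    (z : L2 Ω (EuclideanSpace ℝ (Fin 2))) (i : ℕ) :
    |inner ℝ (e i) (component 0 (S t z))| = ‖modeCoeff e i (S t z)‖ *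
      |Real.cos (b * lam i * t - (modeCoeff e i z).arg)| := by
  rw [← modeCoeff_re, h.norm_modeCoeff_semigroup hS ht, h.modeCoeff_semigroup hS ht]
  set ζ := modeCoeff e i z
  have polar : Complex.exp (-(a + b * Complex.I) * lam i * t) * ζ = (Real.exp (-(a * lam i * t)) *
      ‖ζ‖ : ℝ) * Complex.exp ((-(b * lam i * t - ζ.arg) : ℝ) * Complex.I) := by
    conv_lhs => rw [← Complex.norm_mul_exp_arg_mul_I ζ]
    rw [mul_left_comm, ← Complex.exp_add]
    push_cast
    rw [mul_comm (Complex.exp _) (‖ζ‖ : ℂ), mul_assoc (‖ζ‖ : ℂ), ← Complex.exp_add]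
    ring_nf
  rw [polar, Complex.re_ofReal_mul, Complex.exp_ofReal_mul_I_re, Real.cos_neg, abs_mul,
    abs_of_nonneg (by positivity)]

end SemigroupModes

section HighModes

variable {d : ℕ} {Ω : Set (EuclideanSpace ℝ (Fin d))} {a b : ℝ} {lam : ℕ → ℝ}
  {e : HilbertBasis ℕ ℝ (L2 Ω ℝ)}
  {S : ℝ → L2 Ω (EuclideanSpace ℝ (Fin 2)) →L[ℝ] L2 Ω (EuclideanSpace ℝ (Fin 2))}

/-- The part of `z ∈ L²(Ω; ℝ²)` carried by the modes of index at least `k`. -/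
noncomputable def highModes (e : HilbertBasis ℕ ℝ (L2 Ω ℝ)) (k : ℕ)
    (z : L2 Ω (EuclideanSpace ℝ (Fin 2))) : L2 Ω (EuclideanSpace ℝ (Fin 2)) :=
  z - ∑ i ∈ Finset.range k, modeEmbedding e i (modeCoeff e i z)

lemma highModes_zero (z : L2 Ω (EuclideanSpace ℝ (Fin 2))) : highModes e 0 z = z := by
  simp [highModes]

lemma component_zero_highModes (k : ℕ) (z : L2 Ω (EuclideanSpace ℝ (Fin 2))) :
    component 0 (highModes e k z) =
      component 0 z - ∑ i ∈ Finset.range k, inner ℝ (e i) (component 0 z) • e i := by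
  rw [← componentL_apply, highModes, map_sub, map_sum]
  simp only [componentL_apply, component_modeEmbedding, modeCoeff_re]

lemma modeCoeff_highModes (k i : ℕ) (z : L2 Ω (EuclideanSpace ℝ (Fin 2))) :
    modeCoeff e i (highModes e k z) = if i < k then 0 else modeCoeff e i z := by
  rw [highModes, map_sub, map_sum]
  simp only [modeCoeff_modeEmbedding, Finset.sum_ite_eq, Finset.mem_range]
  split_ifs <;> simp

lemma norm_sq_eq_sum_add_norm_highModes_sq (k : ℕ) (z : L2 Ω (EuclideanSpace ℝ (Fin 2))) :
    ‖z‖ ^ 2 = ∑ i ∈ Finset.range k, ‖modeCoeff e i z‖ ^ 2 + ‖highModes e k z‖ ^ 2 := by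
  have low : HasSum (fun i => if i < k then ‖modeCoeff e i z‖ ^ 2 else 0)
      (∑ i ∈ Finset.range k, ‖modeCoeff e i z‖ ^ 2) := by
    rw [← Finset.sum_congr rfl fun i hi => if_pos (Finset.mem_range.1 hi)]
    exact hasSum_sum_of_ne_finset_zero fun i hi => if_neg (Finset.mem_range.not.1 hi)
  refine (hasSum_norm_modeCoeff_sq e z).unique
    ((low.add (hasSum_norm_modeCoeff_sq e (highModes e k z))).congr_fun fun i => ?_)
  rw [modeCoeff_highModes]
  split_ifs <;> simp

lemma norm_le_sqrt_sum_add_norm_highModes (k : ℕ) (z : L2 Ω (EuclideanSpace ℝ (Fin 2))) :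
    ‖z‖ ≤ √(∑ i ∈ Finset.range k, ‖modeCoeff e i z‖ ^ 2) + ‖highModes e k z‖ := by
  refine le_of_sq_le_sq ?_ (by positivity)
  rw [norm_sq_eq_sum_add_norm_highModes_sq (e := e) k z, add_sq, Real.sq_sqrt (by positivity)]
  have : 0 ≤ 2 * √(∑ i ∈ Finset.range k, ‖modeCoeff e i z‖ ^ 2) * ‖highModes e k z‖ := by
    positivity
  linarith

lemma tendsto_highModes (z : L2 Ω (EuclideanSpace ℝ (Fin 2))) :
    Tendsto (fun k => highModes e k z) atTop (𝓝 0) := by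
  simpa [highModes] using
    (hasSum_modeEmbedding_modeCoeff e z).tendsto_sum_nat.const_sub z

lemma IsDirichletEigenbasis.norm_highModes_semigroup_le (h : IsDirichletEigenbasis Ω lam e)
    (hS : IsSemigroupGeneratedBy S (CoupledOperator Ω a b)) (ha : 0 ≤ a) {k : ℕ} {Λ : ℝ}
    (hk : ∀ i, k ≤ i → Λ ≤ lam i) {t : ℝ} (ht : 0 ≤ t) (z : L2 Ω (EuclideanSpace ℝ (Fin 2))) :
    ‖highModes e k (S t z)‖ ≤ Real.exp (-(a * Λ * t)) * ‖highModes e k z‖ := by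
  refine le_of_sq_le_sq ?_ (by positivity)
  rw [mul_pow]
  refine hasSum_le (fun i => ?_) (hasSum_norm_modeCoeff_sq e (highModes e k (S t z)))
    ((hasSum_norm_modeCoeff_sq e (highModes e k z)).mul_left _)
  simp only [modeCoeff_highModes]
  split_ifs with hi
  · simp
  · rw [h.norm_modeCoeff_semigroup hS ht, mul_pow]
    have := hk i (not_lt.1 hi)
    gcongr

lemma IsDirichletEigenbasis.norm_semigroup_le (h : IsDirichletEigenbasis Ω lam e)
    (hS : IsSemigroupGeneratedBy S (CoupledOperator Ω a b)) (ha : 0 ≤ a)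
    {t : ℝ} (ht : 0 ≤ t) (z : L2 Ω (EuclideanSpace ℝ (Fin 2))) : ‖S t z‖ ≤ ‖z‖ := by
  simpa [highModes_zero] using
    h.norm_highModes_semigroup_le hS ha (k := 0) (fun i _ => h.lam_nonneg i) ht z

lemma IsDirichletEigenbasis.exists_norm_highModes_semigroup_le (h : IsDirichletEigenbasis Ω lam e)
    (hS : IsSemigroupGeneratedBy S (CoupledOperator Ω a b)) (ha : 0 ≤ a)
    {Λ s : ℝ} (hΛ : 0 ≤ Λ) (hs : 0 ≤ s) (z : L2 Ω (EuclideanSpace ℝ (Fin 2))) :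
    ∃ k, (∀ i < k, lam i < Λ) ∧
      ∀ t ≥ s, ‖highModes e k (S t z)‖ ≤ Real.exp (-(a * Λ * s)) * ‖z‖ := by
  rcases eq_or_ne z 0 with rfl | hz
  · exact ⟨0, by simp, by simp [highModes_zero]⟩
  by_cases hex : ∃ k, Λ ≤ lam k
  · classical
    refine ⟨Nat.find hex, fun i hi => not_le.1 (Nat.find_min hex hi), fun t ht => ?_⟩
    set k := Nat.find hex
    have tail_le : ‖highModes e k z‖ ≤ ‖z‖ := by
      refine le_of_sq_le_sq ?_ (norm_nonneg _)
      rw [norm_sq_eq_sum_add_norm_highModes_sq (e := e) k z]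
      exact le_add_of_nonneg_left (by positivity)
    refine (h.norm_highModes_semigroup_le hS ha
      (fun i hi => (Nat.find_spec hex).trans (h.monotone hi)) (hs.trans ht) z).trans ?_
    gcongr
  · -- If every eigenvalue is below `Λ`, cut where the tail of `z` itself is small.
    push Not at hex
    have hpos : 0 < Real.exp (-(a * Λ * s)) * ‖z‖ := by have := norm_pos_iff.2 hz; positivity
    obtain ⟨k, hk⟩ :=
      ((tendsto_highModes (e := e) z).norm.eventually_lt_const (by simpa using hpos)).exists
    refine ⟨k, fun i _ => hex i, fun t ht => ?_⟩
    have := h.norm_highModes_semigroup_le hS ha (k := k) (fun i _ => h.lam_nonneg i) (hs.trans ht) z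
    simp only [mul_zero, zero_mul, neg_zero, Real.exp_zero, one_mul] at this
    exact this.trans hk.le

end HighModes

section L1Norm

variable {d : ℕ} {Ω A : Set (EuclideanSpace ℝ (Fin d))}

lemma integrable_coeFn_L2 {α : Type*} [MeasurableSpace α] {μ : Measure α} [IsFiniteMeasure μ]
    (f : Lp ℝ 2 μ) : Integrable f μ :=
  (Lp.memLp f).integrable one_le_two

lemma integral_abs_le_sqrt_mul_norm {α : Type*} [MeasurableSpace α] {μ : Measure α}
    [IsFiniteMeasure μ] (f : Lp ℝ 2 μ) : ∫ x, |f x| ∂μ ≤ √(μ.real univ) * ‖f‖ := by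
  have norm_one : ‖Lp.const 2 μ (1 : ℝ)‖ = √(μ.real univ) := by
    rw [Lp.norm_const' 2 μ _ two_ne_zero ENNReal.ofNat_ne_top, Real.sqrt_eq_rpow]
    simp
  have cauchy_schwarz := real_inner_le_norm (Lp.const 2 μ (1 : ℝ)) |f|
  rw [norm_abs_eq_norm, L2.inner_def, norm_one] at cauchy_schwarz
  refine (integral_congr_ae ?_).trans_le cauchy_schwarz
  filter_upwards [Lp.coeFn_abs f, Lp.coeFn_const 2 μ (1 : ℝ)] with x habs hconst
  rw [habs, hconst]
  simp

lemma l1NormOn_nonneg (Ω A : Set (EuclideanSpace ℝ (Fin d))) (f : EuclideanSpace ℝ (Fin d) → ℝ) :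
    0 ≤ l1NormOn Ω A f :=
  integral_nonneg fun _ => abs_nonneg _

lemma l1NormOn_congr_ae {f g : EuclideanSpace ℝ (Fin d) → ℝ} (h : f =ᵐ[volume.restrict Ω] g) :
    l1NormOn Ω A f = l1NormOn Ω A g :=
  integral_congr_ae (h.mono fun x hx => by simp only [indicator, hx])

lemma l1NormOn_sum_smul (s : Finset ℕ) (c : ℕ → ℝ) (f : ℕ → L2 Ω ℝ) :
    l1NormOn Ω A (fun x => ∑ i ∈ s, c i * f i x) =
      l1NormOn Ω A (∑ i ∈ s, c i • f i : L2 Ω ℝ) := by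
  refine l1NormOn_congr_ae ?_
  filter_upwards [Lp.coeFn_fun_finsetSum s fun i => c i • f i,
    ae_all_iff.2 fun i => Lp.coeFn_smul (c i) (f i)] with x hsum hsmul
  rw [hsum]
  exact Finset.sum_congr rfl fun i _ => (hsmul i).symm

lemma abs_l1NormOn_sub_le [IsFiniteMeasure (volume.restrict Ω)] (hA : NullMeasurableSet A volume)
    (f g : L2 Ω ℝ) :
    |l1NormOn Ω A f - l1NormOn Ω A g| ≤ √(volume.real Ω) * ‖f - g‖ := by
  have hA' : NullMeasurableSet A (volume.restrict Ω) :=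
    hA.mono_ac Measure.restrict_le_self.absolutelyContinuous
  have integrable (f : L2 Ω ℝ) : Integrable (fun x => |A.indicator f x|) (volume.restrict Ω) :=
    ((integrable_coeFn_L2 f).indicator₀ hA').abs
  rw [l1NormOn, l1NormOn, ← integral_sub (integrable f) (integrable g)]
  have pointwise : ∀ᵐ x ∂volume.restrict Ω,
      |(|A.indicator f x| - |A.indicator g x|)| ≤ |(f - g : L2 Ω ℝ) x| := by
    filter_upwards [Lp.coeFn_sub f g] with x hx
    rw [hx, Pi.sub_apply]
    by_cases h : x ∈ A
    · simpa [h] using abs_abs_sub_abs_le (f x) (g x)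
    · simp [h]
  refine abs_integral_le_integral_abs.trans ((integral_mono_ae
    ((integrable f).sub (integrable g)).abs (integrable_coeFn_L2 (f - g)).abs pointwise).trans ?_)
  simpa using integral_abs_le_sqrt_mul_norm (f - g)

lemma l1NormOn_le [IsFiniteMeasure (volume.restrict Ω)] (hA : NullMeasurableSet A volume)
    (f : L2 Ω ℝ) : l1NormOn Ω A f ≤ √(volume.real Ω) * ‖f‖ := by
  have l1NormOn_zero : l1NormOn Ω A (0 : L2 Ω ℝ) = 0 := by
    rw [l1NormOn_congr_ae (Lp.coeFn_zero ℝ 2 (volume.restrict Ω))]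
    simp [l1NormOn]
  have := abs_l1NormOn_sub_le hA f 0
  rw [l1NormOn_zero, sub_zero, sub_zero] at this
  exact le_of_abs_le this

lemma continuous_l1NormOn [IsFiniteMeasure (volume.restrict Ω)]
    (hA : NullMeasurableSet A volume) : Continuous fun f : L2 Ω ℝ => l1NormOn Ω A f :=
  (LipschitzWith.of_dist_le_mul (K := ⟨√(volume.real Ω), Real.sqrt_nonneg _⟩) fun f g => by
    rw [dist_eq_norm f g]
    exact abs_l1NormOn_sub_le hA f g).continuous

lemma SpectralInequality.sqrt_sum_sq_le [IsFiniteMeasure (volume.restrict Ω)] {lam : ℕ → ℝ}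
    {e : HilbertBasis ℕ ℝ (L2 Ω ℝ)} {D : ℝ} (h : SpectralInequality Ω A lam e D) (hD : 0 ≤ D)
    (hA : NullMeasurableSet A volume) {Λ : ℝ} {k : ℕ} (hk : ∀ i < k, lam i < Λ) (f : L2 Ω ℝ) :
    √(∑ i ∈ Finset.range k, inner ℝ (e i) f ^ 2) ≤ √D * Real.exp (D / 2 * √Λ) *
      (l1NormOn Ω A f + √(volume.real Ω) *
        ‖f - ∑ i ∈ Finset.range k, inner ℝ (e i) f • e i‖) := by
  have hf := l1NormOn_nonneg Ω A f
  rw [Real.sqrt_le_left (by positivity)]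
  rcases k.eq_zero_or_pos with rfl | hk₀
  · simpa using sq_nonneg _
  have exp_sq : (√D * Real.exp (D / 2 * √Λ)) ^ 2 = D * Real.exp (D * √Λ) := by
    rw [mul_pow, Real.sq_sqrt hD, ← Real.exp_nat_mul]
    ring_nf
  refine (h Λ (hk 0 hk₀) k (fun i hi => (hk i hi).le) fun i => inner ℝ (e i) f).trans ?_
  rw [l1NormOn_sum_smul _ _ (fun i => e i), mul_pow, exp_sq]
  gcongr
  · exact l1NormOn_nonneg _ _ _
  have := abs_l1NormOn_sub_le hA (∑ i ∈ Finset.range k, inner ℝ (e i) f • e i) f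
  rw [norm_sub_rev] at this
  linarith [le_of_abs_le this]

/-- The joint integrability hypothesis on `𝒟` is applied to the partial sums of the expansion of
`u` in a Hilbert basis, which are finite sums of products `c (t) e (x)`. -/
lemma aestronglyMeasurable_l1NormOn [IsFiniteMeasure (volume.restrict Ω)]
    (e : HilbertBasis ℕ ℝ (L2 Ω ℝ)) {I : Set ℝ} {𝒟 : ℝ → Set (EuclideanSpace ℝ (Fin d))}
    (hmeas : ∀ᵐ t ∂(volume.restrict I), NullMeasurableSet (𝒟 t) volume)
    (hint : ∀ f : EuclideanSpace ℝ (Fin d) × ℝ → ℝ, IntegrableOn f (Ω ×ˢ I) volume →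
      IntegrableOn (fun t => l1NormOn Ω (𝒟 t) (fun x => f (x, t))) I volume)
    {u : ℝ → L2 Ω ℝ} (hu : IntegrableOn u I) :
    AEStronglyMeasurable (fun t => l1NormOn Ω (𝒟 t) (u t)) (volume.restrict I) := by
  refine aestronglyMeasurable_of_tendsto_ae atTop (f := fun n t => l1NormOn Ω (𝒟 t)
    (∑ i ∈ Finset.range n, inner ℝ (e i) (u t) • e i : L2 Ω ℝ)) (fun n => ?_) ?_
  · simp only [← l1NormOn_sum_smul _ _ (fun i => e i)]
    refine (hint (fun p => ∑ i ∈ Finset.range n, inner ℝ (e i) (u p.2) * e i p.1) ?_).1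
    rw [IntegrableOn, Measure.volume_eq_prod, ← Measure.prod_restrict]
    refine integrable_finsetSum _ fun i _ => ?_
    exact ((integrable_coeFn_L2 (e i)).mul_prod (hu.const_inner (e i))).congr
      (.of_forall fun p => mul_comm _ _)
  · filter_upwards [hmeas] with t ht
    refine ((continuous_l1NormOn ht).tendsto (u t)).comp ?_
    simpa only [e.repr_apply_apply] using (e.hasSum_repr (u t)).tendsto_sum_nat

lemma integrableOn_l1NormOn [IsFiniteMeasure (volume.restrict Ω)]
    (e : HilbertBasis ℕ ℝ (L2 Ω ℝ)) {I : Set ℝ} {𝒟 : ℝ → Set (EuclideanSpace ℝ (Fin d))}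
    (hmeas : ∀ᵐ t ∂(volume.restrict I), NullMeasurableSet (𝒟 t) volume)
    (hint : ∀ f : EuclideanSpace ℝ (Fin d) × ℝ → ℝ, IntegrableOn f (Ω ×ˢ I) volume →
      IntegrableOn (fun t => l1NormOn Ω (𝒟 t) (fun x => f (x, t))) I volume)
    {u : ℝ → L2 Ω ℝ} (hu : IntegrableOn u I) :
    IntegrableOn (fun t => l1NormOn Ω (𝒟 t) (u t)) I volume := by
  refine (hu.norm.const_mul √(volume.real Ω)).mono'
    (aestronglyMeasurable_l1NormOn e hmeas hint hu) ?_
  filter_upwards [hmeas] with t ht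
  rw [Real.norm_eq_abs, abs_of_nonneg (l1NormOn_nonneg _ _ _)]
  exact l1NormOn_le ht _

end L1Norm

lemma sqrt_sum_integral_sq_le {α ι : Type*} [MeasurableSpace α] {μ : Measure α} [Fintype ι]
    {f : ι → α → ℝ} (hf : ∀ i, Integrable (f i) μ) :
    √(∑ i, (∫ x, f i x ∂μ) ^ 2) ≤ ∫ x, √(∑ i, f i x ^ 2) ∂μ := by
  have eval_integral := eval_integral_piLp (q := 2) (f := fun x => WithLp.toLp 2 fun i => f i x) hf
  simpa [EuclideanSpace.norm_eq, eval_integral] using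
    norm_integral_le_integral_norm (μ := μ) fun x => WithLp.toLp 2 fun i => f i x

section Observability

variable {d : ℕ} {Ω : Set (EuclideanSpace ℝ (Fin d))} {a b : ℝ} {lam : ℕ → ℝ}
  {e : HilbertBasis ℕ ℝ (L2 Ω ℝ)}
  {S : ℝ → L2 Ω (EuclideanSpace ℝ (Fin 2)) →L[ℝ] L2 Ω (EuclideanSpace ℝ (Fin 2))}
  {ν₀ α β : ℝ} {F : Set ℝ}

lemma IsSemigroupGeneratedBy.integrableOn_component
    (hS : IsSemigroupGeneratedBy S (CoupledOperator Ω a b)) (hα : 0 ≤ α) (hF : F ⊆ Icc α β)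
    (i : Fin 2) (z : L2 Ω (EuclideanSpace ℝ (Fin 2))) :
    IntegrableOn (fun t => component i (S t z)) F :=
  (((componentL Ω i).continuous.comp_continuousOn (hS.continuousOn z)).mono
    (Icc_subset_Ici_self.trans (Ici_subset_Ici.2 hα))).integrableOn_compact isCompact_Icc
    |>.mono_set hF

lemma IsDirichletEigenbasis.norm_modeCoeff_semigroup_le_setIntegral
    (h : IsDirichletEigenbasis Ω lam e) (hS : IsSemigroupGeneratedBy S (CoupledOperator Ω a b))
    (ha : 0 ≤ a) {i : ℕ} (hν₀ : 0 < ν₀) (hν : ν₀ ≤ |b * lam i|) (hα : 0 ≤ α)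
    (hαβ : α ≤ β) (hF : F ⊆ Icc α β) (z : L2 Ω (EuclideanSpace ℝ (Fin 2))) :
    volume.real F ^ 2 / (4 * (β - α + 2 * Real.pi / ν₀)) * ‖modeCoeff e i (S β z)‖ ≤
      ∫ t in F, |inner ℝ (e i) (component 0 (S t z))| := by
  set φ := (modeCoeff e i z).arg
  refine (mul_le_mul_of_nonneg_right (sq_div_le_setIntegral_abs_cos (φ := φ) hν₀ hν hαβ hF)
    (norm_nonneg _)).trans ?_
  rw [← integral_mul_const]
  have integrable_cos : IntegrableOn
      (fun t => |Real.cos (b * lam i * t - φ)| * ‖modeCoeff e i (S β z)‖) F :=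
    (by fun_prop : Continuous _).continuousOn.integrableOn_compact isCompact_Icc |>.mono_set hF
  have integrable_inner := ((hS.integrableOn_component hα hF 0 z).const_inner (𝕜 := ℝ) (e i)).abs
  refine setIntegral_mono_ae_restrict integrable_cos integrable_inner ?_
  filter_upwards [ae_restrict_of_ae_restrict_of_subset hF (ae_restrict_mem measurableSet_Icc)]
    with t ht
  have ht₀ : 0 ≤ t := hα.trans ht.1
  have decreasing : ‖modeCoeff e i (S β z)‖ ≤ ‖modeCoeff e i (S t z)‖ := by
    rw [h.norm_modeCoeff_semigroup hS ht₀, h.norm_modeCoeff_semigroup hS (ht₀.trans ht.2)]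
    have := h.lam_nonneg i
    gcongr
    exact ht.2
  rw [h.abs_inner_component_zero_semigroup hS ht₀, mul_comm]
  gcongr

lemma IsDirichletEigenbasis.sqrt_sum_norm_modeCoeff_semigroup_le_setIntegral
    (h : IsDirichletEigenbasis Ω lam e) (hS : IsSemigroupGeneratedBy S (CoupledOperator Ω a b))
    (ha : 0 ≤ a) (hν₀ : 0 < ν₀) (hν : ∀ i, ν₀ ≤ |b * lam i|) (hα : 0 ≤ α)
    (hαβ : α ≤ β) (hF : F ⊆ Icc α β) (k : ℕ) (z : L2 Ω (EuclideanSpace ℝ (Fin 2))) :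
    volume.real F ^ 2 / (4 * (β - α + 2 * Real.pi / ν₀)) *
        √(∑ i ∈ Finset.range k, ‖modeCoeff e i (S β z)‖ ^ 2) ≤
      ∫ t in F, √(∑ i ∈ Finset.range k, inner ℝ (e i) (component 0 (S t z)) ^ 2) := by
  set κ := volume.real F ^ 2 / (4 * (β - α + 2 * Real.pi / ν₀))
  have hκ : 0 ≤ κ := by have := sub_nonneg.2 hαβ; positivity
  calc κ * √(∑ i ∈ Finset.range k, ‖modeCoeff e i (S β z)‖ ^ 2)
      = √(∑ i ∈ Finset.range k, (κ * ‖modeCoeff e i (S β z)‖) ^ 2) := by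
        simp only [mul_pow, ← Finset.mul_sum]
        rw [Real.sqrt_mul (by positivity), Real.sqrt_sq hκ]
    _ ≤ √(∑ i ∈ Finset.range k, (∫ t in F, |inner ℝ (e i) (component 0 (S t z))|) ^ 2) := by
        gcongr with i
        exact h.norm_modeCoeff_semigroup_le_setIntegral hS ha hν₀ (hν i) hα hαβ hF z
    _ ≤ ∫ t in F, √(∑ i ∈ Finset.range k, |inner ℝ (e i) (component 0 (S t z))| ^ 2) := by
        simp only [Finset.sum_range]
        exact sqrt_sum_integral_sq_le fun i =>
          ((hS.integrableOn_component hα hF 0 z).const_inner (𝕜 := ℝ) (e i)).abs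
    _ = _ := by simp only [sq_abs]

lemma SpectralInequality.sqrt_sum_inner_component_sq_le [IsFiniteMeasure (volume.restrict Ω)]
    {A : Set (EuclideanSpace ℝ (Fin d))} {D : ℝ} (h : SpectralInequality Ω A lam e D)
    (hD : 0 ≤ D) (hA : NullMeasurableSet A volume) {Λ : ℝ} {k : ℕ} (hk : ∀ i < k, lam i < Λ)
    (z : L2 Ω (EuclideanSpace ℝ (Fin 2))) :
    √(∑ i ∈ Finset.range k, inner ℝ (e i) (component 0 z) ^ 2) ≤
      √D * Real.exp (D / 2 * √Λ) *
        (l1NormOn Ω A (component 0 z) + √(volume.real Ω) * ‖highModes e k z‖) := by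
  refine (h.sqrt_sum_sq_le hD hA hk (component 0 z)).trans ?_
  rw [← component_zero_highModes]
  gcongr
  exact norm_component_le 0 _

lemma IsDirichletEigenbasis.norm_semigroup_le_setIntegral_add
    [IsFiniteMeasure (volume.restrict Ω)] (h : IsDirichletEigenbasis Ω lam e)
    (hS : IsSemigroupGeneratedBy S (CoupledOperator Ω a b)) (ha : 0 ≤ a)
    (hν₀ : 0 < ν₀) (hν : ∀ i, ν₀ ≤ |b * lam i|) {D : ℝ} (hD : 0 ≤ D) (hα : 0 ≤ α) (hαβ : α ≤ β)
    (hF : F ⊆ Icc α β) (hF₀ : 0 < volume.real F) {𝒟 : ℝ → Set (EuclideanSpace ℝ (Fin d))}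
    (h𝒟 : ∀ᵐ t ∂volume.restrict F,
      NullMeasurableSet (𝒟 t) volume ∧ SpectralInequality Ω (𝒟 t) lam e D)
    {z : L2 Ω (EuclideanSpace ℝ (Fin 2))}
    (hobs : IntegrableOn (fun t => l1NormOn Ω (𝒟 t) (component 0 (S t z))) F) {Λ : ℝ}
    (hΛ : 0 ≤ Λ) :
    ‖S β z‖ ≤ 4 * (β - α + 2 * Real.pi / ν₀) / volume.real F * (√D * Real.exp (D / 2 * √Λ)) *
        (1 / volume.real F * (∫ t in F, l1NormOn Ω (𝒟 t) (component 0 (S t z))) +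
          √(volume.real Ω) * (Real.exp (-(a * Λ * α)) * ‖z‖)) +
      Real.exp (-(a * Λ * α)) * ‖z‖ := by
  obtain ⟨k, hk, hhigh⟩ := h.exists_norm_highModes_semigroup_le hS ha hΛ hα z
  set δ := Real.exp (-(a * Λ * α)) * ‖z‖
  set m := volume.real F
  set C := √(volume.real Ω)
  set L := β - α + 2 * Real.pi / ν₀
  set Q := √D * Real.exp (D / 2 * √Λ)
  set R := √(∑ i ∈ Finset.range k, ‖modeCoeff e i (S β z)‖ ^ 2)
  set I := ∫ t in F, l1NormOn Ω (𝒟 t) (component 0 (S t z))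
  have hL : 0 < L := by have := sub_nonneg.2 hαβ; positivity
  have F_ne_top : volume F ≠ ⊤ := measure_ne_top_of_subset hF isCompact_Icc.measure_ne_top
  have integrable_const : IntegrableOn (fun _ : ℝ => C * δ) F := integrableOn_const F_ne_top
  have final_le : ‖S β z‖ ≤ R + δ :=
    (norm_le_sqrt_sum_add_norm_highModes k (S β z)).trans (by gcongr; exact hhigh β hαβ)
  have pointwise : ∀ᵐ t ∂volume.restrict F,
      √(∑ i ∈ Finset.range k, inner ℝ (e i) (component 0 (S t z)) ^ 2) ≤
        Q * (l1NormOn Ω (𝒟 t) (component 0 (S t z)) + C * δ) := by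
    filter_upwards [h𝒟, ae_restrict_of_ae_restrict_of_subset hF
      (ae_restrict_mem measurableSet_Icc)] with t ⟨hmeas, hspec⟩ ht
    refine (hspec.sqrt_sum_inner_component_sq_le hD hmeas hk (S t z)).trans ?_
    gcongr
    exact hhigh t ht.1
  have low_le : m ^ 2 / (4 * L) * R ≤ Q * (I + m * (C * δ)) := by
    refine (h.sqrt_sum_norm_modeCoeff_semigroup_le_setIntegral hS ha hν₀ hν hα hαβ hF k
      z).trans ((integral_mono_of_nonneg (.of_forall fun _ => Real.sqrt_nonneg _)
        ((hobs.add integrable_const).const_mul Q) pointwise).trans_eq ?_)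
    rw [integral_const_mul, integral_add' hobs integrable_const, setIntegral_const, smul_eq_mul]
  have R_le : R ≤ 4 * L / m * Q * (1 / m * I + C * δ) := by
    calc R ≤ Q * (I + m * (C * δ)) / (m ^ 2 / (4 * L)) := by
          rwa [le_div_iff₀' (by positivity)]
      _ = _ := by field_simp
  linarith

end Observability

section Interpolation

variable {a s N X Z P β θ : ℝ}

lemma mul_sqrt_le_add_sq_div {c x : ℝ} (hc : 0 < c) (hx : 0 ≤ x) (β : ℝ) :
    β * √x ≤ c * x + β ^ 2 / (4 * c) := by
  have : c * x + β ^ 2 / (4 * c) - β * √x = (2 * c * √x - β) ^ 2 / (4 * c) := by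
    nth_rewrite 1 [← Real.sq_sqrt hx]
    field_simp
    ring
  have : 0 ≤ (2 * c * √x - β) ^ 2 / (4 * c) := by positivity
  linarith

/-- `Λ` is chosen such that `exp (-a Λ s) N = X`. -/
lemma le_rpow_mul_rpow_of_forall_frequency_of_pos (ha : 0 < a) (hs : 0 < s) (hN : 0 < N)
    (hX : 0 < X) (hP : 1 ≤ P) (hZN : Z ≤ N) (hθ : θ ∈ Ioo (0 : ℝ) 1)
    (h : ∀ Λ, 0 ≤ Λ → Z ≤ P * Real.exp (β * √Λ) * (X + Real.exp (-(a * Λ * s)) * N)) :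
    Z ≤ 2 * P * Real.exp (β ^ 2 / (4 * a) / (θ * s)) * X ^ (1 - θ) * N ^ θ := by
  obtain ⟨hθ₀, hθ₁⟩ := hθ
  set K := Real.exp (β ^ 2 / (4 * a) / (θ * s))
  have hK : 1 ≤ K := Real.one_le_exp (by positivity)
  rcases le_total N X with hNX | hXN
  · calc Z ≤ 1 * N ^ (1 - θ) * N ^ θ := by
          rwa [one_mul, ← Real.rpow_add hN, sub_add_cancel, Real.rpow_one]
      _ ≤ 2 * P * K * X ^ (1 - θ) * N ^ θ := by
          gcongr
          nlinarith
  · set l := Real.log (N / X)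
    have hl : 0 ≤ l := Real.log_nonneg ((one_le_div hX).2 hXN)
    have exp_l : Real.exp l = N / X := Real.exp_log (by positivity)
    set Λ := l / (a * s) with hΛ
    have aΛs : a * Λ * s = l := by rw [hΛ]; field_simp
    have hΛ₀ : 0 ≤ Λ := by positivity
    have dissipation : Real.exp (-(a * Λ * s)) * N = X := by
      rw [aΛs, Real.exp_neg, exp_l]; field_simp
    have cost : Real.exp (β * √Λ) ≤ (N / X) ^ θ * K := by
      rw [← exp_l, ← Real.exp_mul, ← Real.exp_add, Real.exp_le_exp, ← aΛs]
      refine (mul_sqrt_le_add_sq_div (by positivity : 0 < a * θ * s) hΛ₀ β).trans_eq ?_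
      field_simp
    calc Z ≤ P * Real.exp (β * √Λ) * (X + X) := by simpa only [dissipation] using h Λ hΛ₀
      _ ≤ P * ((N / X) ^ θ * K) * (X + X) := by gcongr
      _ = 2 * P * K * X ^ (1 - θ) * N ^ θ := by
          rw [Real.div_rpow hN.le hX.le, Real.rpow_sub hX, Real.rpow_one]
          ring

lemma le_rpow_mul_rpow_of_forall_frequency (ha : 0 < a) (hs : 0 < s) (hN : 0 ≤ N) (hX : 0 ≤ X)
    (hP : 1 ≤ P) (hZN : Z ≤ N) (hθ : θ ∈ Ioo (0 : ℝ) 1)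
    (h : ∀ Λ, 0 ≤ Λ → Z ≤ P * Real.exp (β * √Λ) * (X + Real.exp (-(a * Λ * s)) * N)) :
    Z ≤ 2 * P * Real.exp (β ^ 2 / (4 * a) / (θ * s)) * X ^ (1 - θ) * N ^ θ := by
  rcases hN.eq_or_lt with rfl | hN
  · exact hZN.trans (by positivity)
  set bound : ℝ → ℝ := fun Y =>
    2 * P * Real.exp (β ^ 2 / (4 * a) / (θ * s)) * Y ^ (1 - θ) * N ^ θ
  have continuous_bound : Continuous bound :=
    (continuous_const.mul (Real.continuous_rpow_const (sub_nonneg.2 hθ.2.le))).mul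
      continuous_const
  refine ge_of_tendsto (continuous_bound.continuousWithinAt (s := Ioi X)).tendsto
    (eventually_nhdsWithin_of_forall fun Y hY => ?_)
  refine le_rpow_mul_rpow_of_forall_frequency_of_pos ha hs hN (hX.trans_lt hY) hP hZN hθ
    fun Λ hΛ => (h Λ hΛ).trans ?_
  gcongr
  exact (mem_Ioi.1 hY).le

end Interpolation

lemma measureReal_le_of_subset_Icc {F : Set ℝ} {α β : ℝ} (hα : 0 ≤ α) (hαβ : α ≤ β)
    (hF : F ⊆ Icc α β) : volume.real F ≤ β :=
  calc volume.real F ≤ volume.real (Icc α β) := measureReal_mono hF (by simp)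
    _ = β - α := Real.volume_real_Icc_of_le hαβ
    _ ≤ β := sub_le_self β hα

section MainEstimate

variable {d : ℕ} {Ω : Set (EuclideanSpace ℝ (Fin d))} {a b : ℝ} {lam : ℕ → ℝ}
  {e : HilbertBasis ℕ ℝ (L2 Ω ℝ)}
  {S : ℝ → L2 Ω (EuclideanSpace ℝ (Fin 2)) →L[ℝ] L2 Ω (EuclideanSpace ℝ (Fin 2))}
  {ν₀ α β : ℝ} {F : Set ℝ}

lemma IsDirichletEigenbasis.norm_semigroup_le_rpow_mul_rpow
    [IsFiniteMeasure (volume.restrict Ω)] (h : IsDirichletEigenbasis Ω lam e)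
    (hS : IsSemigroupGeneratedBy S (CoupledOperator Ω a b)) (ha : 0 < a)
    (hν₀ : 0 < ν₀) (hν : ∀ i, ν₀ ≤ |b * lam i|) {D : ℝ} (hD : 0 ≤ D) (hα : 0 < α) (hαβ : α ≤ β)
    (hF : F ⊆ Icc α β) (hF₀ : 0 < volume.real F) {𝒟 : ℝ → Set (EuclideanSpace ℝ (Fin d))}
    (h𝒟 : ∀ᵐ t ∂volume.restrict F,
      NullMeasurableSet (𝒟 t) volume ∧ SpectralInequality Ω (𝒟 t) lam e D)
    {z : L2 Ω (EuclideanSpace ℝ (Fin 2))}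
    (hobs : IntegrableOn (fun t => l1NormOn Ω (𝒟 t) (component 0 (S t z))) F) {θ : ℝ}
    (hθ : θ ∈ Ioo (0 : ℝ) 1) :
    ‖S β z‖ ≤ 2 * (4 * (β + 2 * Real.pi / ν₀) / volume.real F *
        (√D * (1 + √(volume.real Ω)) + 1)) * Real.exp ((D / 2) ^ 2 / (4 * a) / (θ * α)) *
      (1 / volume.real F * ∫ t in F, l1NormOn Ω (𝒟 t) (component 0 (S t z))) ^ (1 - θ) *
        ‖z‖ ^ θ := by
  have measure_le : volume.real F ≤ β := measureReal_le_of_subset_Icc hα.le hαβ hF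
  set m := volume.real F
  set C := √(volume.real Ω)
  set c₀ := 2 * Real.pi / ν₀
  set X := 1 / m * ∫ t in F, l1NormOn Ω (𝒟 t) (component 0 (S t z))
  have hX : 0 ≤ X := mul_nonneg (by positivity) (integral_nonneg fun t => l1NormOn_nonneg _ _ _)
  have hc₀ : 0 ≤ c₀ := by positivity
  have hL : 1 ≤ 4 * (β + c₀) / m := by rw [le_div_iff₀ hF₀]; linarith
  have hβ : 0 ≤ β := hα.le.trans hαβ
  refine le_rpow_mul_rpow_of_forall_frequency ha hα (norm_nonneg z) hX
    (one_le_mul_of_one_le_of_one_le hL (le_add_of_nonneg_left (by positivity)))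
    (h.norm_semigroup_le hS ha.le hβ z) hθ fun Λ hΛ => ?_
  set δ := Real.exp (-(a * Λ * α)) * ‖z‖
  have hδ : 0 ≤ δ := by positivity
  have hexp : 1 ≤ Real.exp (D / 2 * √Λ) := Real.one_le_exp (by positivity)
  calc ‖S β z‖
      ≤ 4 * (β - α + c₀) / m * (√D * Real.exp (D / 2 * √Λ)) * (X + C * δ) + δ :=
        h.norm_semigroup_le_setIntegral_add hS ha.le hν₀ hν hD hα.le hαβ hF hF₀ h𝒟 hobs hΛ
    _ ≤ 4 * (β + c₀) / m * (√D * Real.exp (D / 2 * √Λ)) * ((1 + C) * (X + δ)) +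
        4 * (β + c₀) / m * Real.exp (D / 2 * √Λ) * (X + δ) := by
        refine add_le_add ?_ ?_
        · gcongr
          · linarith
          · nlinarith [(by positivity : 0 ≤ C * X)]
        · nlinarith [one_le_mul_of_one_le_of_one_le hL hexp]
    _ = _ := by ring

end MainEstimate

/-- The three summands of the final constant come from the factor `8 (1 + c₀) G`, from
`(1 + s₂) ^ 3 ≤ exp (3 s₂)`, and from the exponent `γ`. -/
lemma prefactor_mul_exp_le {G c₀ γ m s₁ s₂ θ : ℝ} (hG : 0 ≤ G) (hc₀ : 0 ≤ c₀) (hγ : 0 ≤ γ)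
    (hm : 0 < m) (hms : m ≤ s₂) (hs₁ : 0 < s₁) (hθ : θ ∈ Ioo (0 : ℝ) 1) :
    2 * (4 * (s₂ + c₀) / m * G) * Real.exp (γ / (θ * s₁)) ≤
      (8 * (1 + c₀) * G + 3 + γ) *
        Real.exp ((8 * (1 + c₀) * G + 3 + γ) * (s₂ / (1 - θ) + 1 / (θ * s₁))) / m ^ 3 := by
  obtain ⟨hθ₀, hθ₁⟩ := hθ
  have hs₂ : 0 < s₂ := hm.trans_le hms
  have hG' : 0 ≤ 8 * (1 + c₀) * G := by positivity
  set M := 8 * (1 + c₀) * G + 3 + γ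
  have polynomial_le : (s₂ + c₀) * m ^ 2 ≤ (1 + c₀) * Real.exp (3 * s₂) := by
    calc (s₂ + c₀) * m ^ 2 ≤ ((1 + c₀) * (1 + s₂)) * (1 + s₂) ^ 2 := by
          gcongr
          · nlinarith
          · linarith
      _ = (1 + c₀) * (s₂ + 1) ^ 3 := by ring
      _ ≤ (1 + c₀) * Real.exp s₂ ^ 3 := by gcongr; exact Real.add_one_le_exp s₂
      _ = _ := by rw [← Real.exp_nat_mul]; norm_num
  have exp_le : Real.exp (3 * s₂) * Real.exp (γ / (θ * s₁)) ≤
      Real.exp (M * (s₂ / (1 - θ) + 1 / (θ * s₁))) := by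
    rw [← Real.exp_add, mul_add, mul_one_div]
    have : 0 < 1 - θ := by linarith
    gcongr
    · linarith
    · exact le_div_self hs₂.le this (by linarith)
    · linarith
  calc 2 * (4 * (s₂ + c₀) / m * G) * Real.exp (γ / (θ * s₁))
      = 8 * G * ((s₂ + c₀) * m ^ 2) * Real.exp (γ / (θ * s₁)) / m ^ 3 := by field_simp; ring
    _ ≤ 8 * G * ((1 + c₀) * Real.exp (3 * s₂)) * Real.exp (γ / (θ * s₁)) / m ^ 3 := by gcongr
    _ = 8 * (1 + c₀) * G * (Real.exp (3 * s₂) * Real.exp (γ / (θ * s₁))) / m ^ 3 := by ring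
    _ ≤ _ := by
      gcongr
      linarith

lemma intervalIntegral_indicator_eq_setIntegral {E : Set ℝ} (hE : NullMeasurableSet E volume)
    {α β : ℝ} (hαβ : α ≤ β) (f : ℝ → ℝ) :
    ∫ t in α..β, E.indicator f t = ∫ t in E ∩ Icc α β, f t := by
  have hE' := hE.mono_ac (Measure.restrict_le_self (s := Icc α β)).absolutelyContinuous
  rw [intervalIntegral.integral_of_le hαβ, ← integral_Icc_eq_integral_Ioc,
    integral_indicator₀ hE', Measure.restrict_restrict₀ hE']

lemma exists_pos_forall_le_lam {d : ℕ} {Ω : Set (EuclideanSpace ℝ (Fin d))}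
    {π : EuclideanSpace ℝ (Fin d) →L[ℝ] ℝ} (hπ : π ≠ 0) (hΩ : Bornology.IsBounded (π '' Ω)) :
    ∃ l₀ > 0, ∀ (lam : ℕ → ℝ) (e : HilbertBasis ℕ ℝ (L2 Ω ℝ)), IsDirichletEigenbasis Ω lam e →
      ∀ i, l₀ ≤ lam i := by
  obtain ⟨v, hv⟩ : ∃ v, π v = 1 :=
    π.toLinearMap.surjective_of_ne_zero (fun h => hπ (ContinuousLinearMap.coe_injective h)) 1
  obtain ⟨R, hR₀, hR⟩ := hΩ.exists_pos_norm_le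
  have hv₀ : 0 < ‖v‖ := norm_pos_iff.2 fun h => by simp [h] at hv
  refine ⟨1 / (4 * R ^ 2 * ‖v‖ ^ 2), by positivity, fun lam e h i => ?_⟩
  rw [div_le_iff₀' (by positivity)]
  exact h.one_le_mul_lam hv (fun x hx => hR _ (mem_image_of_mem π hx)) i

theorem theorem3p1_general {d : ℕ} {Ω : Set (EuclideanSpace ℝ (Fin d))} (hΩ : volume Ω ≠ ⊤)
    {π : EuclideanSpace ℝ (Fin d) →L[ℝ] ℝ} (hπ : π ≠ 0) (hπΩ : Bornology.IsBounded (π '' Ω))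
    {a b : ℝ} (ha : 0 < a) (hb : b ≠ 0) {D : ℝ} (hD : 0 ≤ D) :
    ∃ M : ℝ, 0 < M ∧
      ∀ (lam : ℕ → ℝ) (e : HilbertBasis ℕ ℝ (L2 Ω ℝ)), IsDirichletEigenbasis Ω lam e →
      ∀ S : ℝ → L2 Ω (EuclideanSpace ℝ (Fin 2)) →L[ℝ] L2 Ω (EuclideanSpace ℝ (Fin 2)),
        IsSemigroupGeneratedBy S (CoupledOperator Ω a b) →
      ∀ (T : ℝ) (E : Set ℝ) (𝒟 : ℝ → Set (EuclideanSpace ℝ (Fin d))),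
        E ⊆ Ioo 0 T → NullMeasurableSet E volume →
        (∀ᵐ t ∂(volume.restrict (Ioo 0 T)), NullMeasurableSet (𝒟 t) volume) →
        (∀ f : EuclideanSpace ℝ (Fin d) × ℝ → ℝ, IntegrableOn f (Ω ×ˢ Ioo 0 T) volume →
          IntegrableOn (fun t => l1NormOn Ω (𝒟 t) (fun x => f (x, t))) (Ioo 0 T) volume) →
        (∀ᵐ t ∂volume, t ∈ E → SpectralInequality Ω (𝒟 t) lam e D) →
      ∀ θ ∈ Ioo (0 : ℝ) 1, ∀ S₁ S₂ : ℝ, 0 < S₁ → S₁ < S₂ → 0 < volume (E ∩ Icc S₁ S₂) →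
      ∀ z : L2 Ω (EuclideanSpace ℝ (Fin 2)),
        IntervalIntegrable
          (E.indicator fun t => l1NormOn Ω (𝒟 t) (component 0 (S t z))) volume S₁ S₂ ∧
        ‖S S₂ z‖ ≤
          M * Real.exp (M * (S₂ / (1 - θ) + 1 / (θ * S₁))) / volume.real (E ∩ Icc S₁ S₂) ^ 3 *
            (1 / volume.real (E ∩ Icc S₁ S₂) *
              ∫ t in S₁..S₂,
                E.indicator (fun t => l1NormOn Ω (𝒟 t) (component 0 (S t z))) t) ^ (1 - θ) *
            ‖z‖ ^ θ := by
  have : IsFiniteMeasure (volume.restrict Ω) := ⟨by simpa using hΩ.lt_top⟩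
  obtain ⟨l₀, hl₀, hlam⟩ := exists_pos_forall_le_lam hπ hπΩ
  set c₀ := 2 * Real.pi / (|b| * l₀)
  set G := √D * (1 + √(volume.real Ω)) + 1
  set γ := (D / 2) ^ 2 / (4 * a)
  refine ⟨8 * (1 + c₀) * G + 3 + γ, by positivity, ?_⟩
  intro lam e he S hS T E 𝒟 hE hEm hmeas hint hspec θ hθ S₁ S₂ hS₁ hS₁₂ hvol z
  have hobs : IntegrableOn (fun t => l1NormOn Ω (𝒟 t) (component 0 (S t z))) E :=
    (integrableOn_l1NormOn e hmeas hint
      (hS.integrableOn_component le_rfl Ioo_subset_Icc_self 0 z)).mono_set hE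
  refine ⟨(hobs.integrable_indicator₀ hEm).intervalIntegrable, ?_⟩
  have frequency_ge (i : ℕ) : |b| * l₀ ≤ |b * lam i| := by
    rw [abs_mul]
    gcongr
    exact (hlam lam e he i).trans (le_abs_self _)
  have h𝒟 : ∀ᵐ t ∂volume.restrict (E ∩ Icc S₁ S₂),
      NullMeasurableSet (𝒟 t) volume ∧ SpectralInequality Ω (𝒟 t) lam e D := by
    refine ae_restrict_of_ae_restrict_of_subset inter_subset_left
      ((ae_restrict_of_ae_restrict_of_subset hE hmeas).and ?_)
    rwa [ae_restrict_iff'₀ hEm]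
  have hm : 0 < volume.real (E ∩ Icc S₁ S₂) := ENNReal.toReal_pos hvol.ne'
    (measure_ne_top_of_subset inter_subset_right isCompact_Icc.measure_ne_top)
  have measure_le : volume.real (E ∩ Icc S₁ S₂) ≤ S₂ :=
    measureReal_le_of_subset_Icc hS₁.le hS₁₂.le inter_subset_right
  rw [intervalIntegral_indicator_eq_setIntegral hEm hS₁₂.le]
  refine (he.norm_semigroup_le_rpow_mul_rpow hS ha (by positivity) frequency_ge hD hS₁
    hS₁₂.le inter_subset_right hm h𝒟 (hobs.mono_set inter_subset_left) hθ).trans ?_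
  have hX : 0 ≤ ∫ t in E ∩ Icc S₁ S₂, l1NormOn Ω (𝒟 t) (component 0 (S t z)) :=
    integral_nonneg fun t => l1NormOn_nonneg _ _ _
  gcongr ?_ * _ * _
  exact prefactor_mul_exp_le (by positivity) (by positivity) (by positivity) hm measure_le hS₁ hθ

theorem theorem3p1 {d : ℕ} (hd : 0 < d) (Ω : Set (EuclideanSpace ℝ (Fin d)))
    (hΩ_open : IsOpen Ω) (hΩ_conn : IsConnected Ω) (hΩ_bdd : Bornology.IsBounded Ω)
    (a b : ℝ) (ha : 0 < a) (hb : b ≠ 0) (D : ℝ) (hD : 0 < D) :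
    ∃ M : ℝ, 0 < M ∧
      ∀ (lam : ℕ → ℝ) (e : HilbertBasis ℕ ℝ (L2 Ω ℝ)), IsDirichletEigenbasis Ω lam e →
      ∀ S : ℝ → L2 Ω (EuclideanSpace ℝ (Fin 2)) →L[ℝ] L2 Ω (EuclideanSpace ℝ (Fin 2)),
        IsSemigroupGeneratedBy S (CoupledOperator Ω a b) →
      ∀ (T : ℝ) (E : Set ℝ) (𝒟 : ℝ → Set (EuclideanSpace ℝ (Fin d))),
        0 < T → E ⊆ Ioo 0 T → NullMeasurableSet E volume → 0 < volume E →
        (∀ t ∈ Ioo 0 T, 𝒟 t ⊆ Ω) →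
        (∀ᵐ t ∂(volume.restrict (Ioo 0 T)), NullMeasurableSet (𝒟 t) volume) →
        (∀ f : EuclideanSpace ℝ (Fin d) × ℝ → ℝ, IntegrableOn f (Ω ×ˢ Ioo 0 T) volume →
          IntegrableOn (fun t => l1NormOn Ω (𝒟 t) (fun x => f (x, t))) (Ioo 0 T) volume) →
        (∀ᵐ t ∂volume, t ∈ E → SpectralInequality Ω (𝒟 t) lam e D) →
      ∀ θ ∈ Ioo (0 : ℝ) 1, ∀ S₁ S₂ : ℝ, 0 < S₁ → S₁ < S₂ → S₂ ≤ T →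
        0 < volume (E ∩ Icc S₁ S₂) →
      ∀ z : L2 Ω (EuclideanSpace ℝ (Fin 2)),
        IntervalIntegrable
          (E.indicator fun t => l1NormOn Ω (𝒟 t) (component 0 (S t z))) volume S₁ S₂ ∧
        ‖S S₂ z‖ ≤
          M * Real.exp (M * (S₂ / (1 - θ) + 1 / (θ * S₁))) / volume.real (E ∩ Icc S₁ S₂) ^ 3 *
            (1 / volume.real (E ∩ Icc S₁ S₂) *
              ∫ t in S₁..S₂,
                E.indicator (fun t => l1NormOn Ω (𝒟 t) (component 0 (S t z))) t) ^ (1 - θ) *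
            ‖z‖ ^ θ := by
  have hπ : (EuclideanSpace.proj ⟨0, hd⟩ : EuclideanSpace ℝ (Fin d) →L[ℝ] ℝ) ≠ 0 := fun h => by
    simpa using DFunLike.congr_fun h (EuclideanSpace.single ⟨0, hd⟩ 1)
  obtain ⟨M, hM, hbound⟩ := theorem3p1_general hΩ_bdd.measure_lt_top.ne hπ
    ((ContinuousLinearMap.lipschitz _).isBounded_image hΩ_bdd) ha hb hD.le
  exact ⟨M, hM, fun lam e he S hS T E 𝒟 _ hE hEm _ _ hmeas hint hspec θ hθ S₁ S₂ hS₁ hS₁₂ _ =>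
    hbound lam e he S hS T E 𝒟 hE hEm hmeas hint hspec θ hθ S₁ S₂ hS₁ hS₁₂⟩
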